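/- Let $0<q<1$ and $\alpha>-1$. For $n\in\mathbb N_0$ put $(a;q)_n=\prod_{k=0}^{n-1}(1-aq^k)$, $(a;q)_\infty=\prod_{k\ge 0}(1-aq^k)$ and $[n]_q!=\prod_{k=1}^n\frac{1-q^k}{1-q}$. Let $$\exp_q(z)=\sum_{n=0}^\infty \frac{q^{n(n-1)/4}}{(q;q)_n}\,(z(1-q))^n\qquad(z\in\mathbb C)$$ be Exton's $q$-exponential function, and let $$C_q(z)=\tfrac12\big(\exp_q(iz)+\exp_q(-iz)\big),\qquad S_q(z)=\tfrac1{2i}\big(\exp_q(iz)-\exp_q(-iz)\big).$$ For $0<p<1$ let $$J^{(3)}_\alpha(z;p)=\frac{(p^{\alpha+1};p)_\infty}{(p;p)_\infty}\sum_{n=0}^\infty(-1)^n\frac{p^{n(n+1)/2}z^{2n+\alpha}}{(p;p)_n(p^{\alpha+1};p)_n},\qquad \mathcal J^{(3)}_\alpha(z;p)=\frac{(p;p)_\infty}{(p^{\alpha+1};p)_\infty}\,z^{-\alpha}J^{(3)}_\alpha(z;p),$$ where $\mathcal J^{(3)}_\alpha(\cdot;p)$ is regarded as an entire function. Let $j^{(3)}_{1,\alpha}$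 be the smallest positive zero of $J^{(3)}_\alpha(\cdot;q^2)$, and put $$\eta_{\alpha,1}=\frac{q^{1/4}j^{(3)}_{1,\alpha}}{1-q},\qquad g^{(3)}_\alpha(t;q)=\mathcal J^{(3)}_\alpha\big(\tfrac t2(1-q)q^{-1/4};q^2\big).$$ Define $B^{(3)}_{n,\alpha}(z;q)$ as $[n]_q!$ times the $n$-th Taylor coefficient at $t=0$ of the generating function $$\frac{\exp_q(zt)\exp_q(-t/2)}{g^{(3)}_\alpha(it;q)}=\sum_{n=0}^\infty B^{(3)}_{n,\alpha}(z;q)\frac{t^n}{[n]_q!}.$$ Then the smallest positive zero $j^{(3)}_{1,\alpha}$ exists, $D:=\frac{d}{dz}\mathcal J^{(3)}_\alpha(z;q^2)\big|_{z=j^{(3)}_{1,\alpha}}\ne0$, and for every $z\in\mathbb C$ and every real $r$ with $0<r\le 2\eta_{\alpha,1}$, as $n\to\infty$, $$B^{(3)}_{2n,\alpha}(z;q)=\frac{4q^{1/4}}{1-q}\,\frac{(-1)^{n+1}[2n]_q!\,\big(C_q(2\eta_{\alpha,1}z)C_q(\eta_{\alpha,1})+S_q(2\eta_{\alpha,1}z)S_q(\eta_{\alpha,1})\big)}{(2\eta_{\alpha,1})^{2n+1}\,D}+[2n]_q!\;o(r^{-2n}),$$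 $$B^{(3)}_{2n+1,\alpha}(z;q)=\frac{4q^{1/4}}{1-q}\,\frac{(-1)^{n+1}[2n+1]_q!\,\big(S_q(2\eta_{\alpha,1}z)C_q(\eta_{\alpha,1})-C_q(2\eta_{\alpha,1}z)S_q(\eta_{\alpha,1})\big)}{(2\eta_{\alpha,1})^{2n+2}\,D}+[2n+1]_q!\;o(r^{-2n}).$$ -/

import Mathlib

noncomputable section

namespace QBern

open Complex

/-- The finite `q`-shifted factorial `(a; q)_n = ∏_{k < n} (1 - a q^k)`. -/
def qShift (a q : ℝ) (n : ℕ) : ℝ := ∏ k ∈ Finset.range n, (1 - a * q ^ k)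

/-- The infinite `q`-shifted factorial `(a; q)_∞ = ∏_{k ≥ 0} (1 - a q^k)`. -/
def qShiftInf (a q : ℝ) : ℝ := ∏' k : ℕ, (1 - a * q ^ k)

/-- The `q`-factorial `[n]_q! = ∏_{k = 1}^{n} (1 - q^k) / (1 - q)`. -/
def qFact (q : ℝ) (n : ℕ) : ℝ := ∏ k ∈ Finset.range n, (1 - q ^ (k + 1)) / (1 - q)

/-- Exton's `q`-exponential function
`exp_q(z) = ∑ q^{n(n-1)/4} (z(1-q))^n / (q;q)_n`. -/
def qExp (q : ℝ) (z : ℂ) : ℂ :=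
  ∑' n : ℕ, (((q ^ ((n : ℝ) * ((n : ℝ) - 1) / 4) / qShift q q n : ℝ)) : ℂ) * (z * (1 - (q : ℂ))) ^ n

/-- The `q`-cosine attached to `exp_q`: the even part of `z ↦ exp_q(iz)`. -/
def qCos (q : ℝ) (z : ℂ) : ℂ := (qExp q (I * z) + qExp q (-(I * z))) / 2

/-- The `q`-sine attached to `exp_q`: the odd part of `z ↦ exp_q(iz)`, divided by `i`. -/
def qSin (q : ℝ) (z : ℂ) : ℂ := (qExp q (I * z) - qExp q (-(I * z))) / (2 * I)

/-- The third Jackson (Hahn-Exton) `q`-Bessel function `J_α^{(3)}(z; p)`, with the principal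
branch of `z^{2n+α}`. -/
def besselJ (α p : ℝ) (z : ℂ) : ℂ :=
  ((qShiftInf (p ^ (α + 1)) p / qShiftInf p p : ℝ) : ℂ) *
    ∑' n : ℕ, (-1 : ℂ) ^ n * ((p ^ (n * (n + 1) / 2) : ℝ) : ℂ) * z ^ ((2 * n + α : ℝ) : ℂ) /
      ((qShift p p n * qShift (p ^ (α + 1)) p n : ℝ) : ℂ)

/-- The modified function `𝒥_α^{(3)}(z; p) = (p;p)_∞ / (p^{α+1};p)_∞ * z^{-α} J_α^{(3)}(z; p)`,
as an entire function of `z`; see `besselModJ_eq`. -/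
def besselModJ (α p : ℝ) (z : ℂ) : ℂ :=
  ∑' n : ℕ, (-1 : ℂ) ^ n * ((p ^ (n * (n + 1) / 2) : ℝ) : ℂ) * z ^ (2 * n) /
    ((qShift p p n * qShift (p ^ (α + 1)) p n : ℝ) : ℂ)

theorem qShiftInf_ne_zero {a p : ℝ} (ha0 : 0 < a) (ha1 : a < 1) (hp0 : 0 < p) (hp1 : p < 1) :
    qShiftInf a p ≠ 0 := by
  have h : ∏' k : ℕ, (1 + (-(a * p ^ k))) ≠ 0 := by
    apply tprod_one_add_ne_zero_of_summable
    · intro k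
      have h1 : p ^ k ≤ 1 := pow_le_one₀ hp0.le hp1.le
      have h2 : 0 < p ^ k := by positivity
      nlinarith
    · have h3 := (summable_geometric_of_lt_one hp0.le hp1).mul_left a
      refine h3.congr fun k => ?_
      rw [norm_neg, Real.norm_of_nonneg (by positivity)]
  simpa [qShiftInf, sub_eq_add_neg] using h

/-- The modified function is the stated normalization of the `q`-Bessel function. -/
theorem besselModJ_eq {α p : ℝ} (hα : -1 < α) (hp0 : 0 < p) (hp1 : p < 1) {z : ℂ} (hz : z ≠ 0) :
    besselModJ α p z =
      ((qShiftInf p p / qShiftInf (p ^ (α + 1)) p : ℝ) : ℂ) * z ^ (-(α : ℂ)) * besselJ α p z := by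
  have h1 : qShiftInf p p ≠ 0 := qShiftInf_ne_zero hp0 hp1 hp0 hp1
  have h2 : qShiftInf (p ^ (α + 1)) p ≠ 0 :=
    qShiftInf_ne_zero (Real.rpow_pos_of_pos hp0 _)
      (Real.rpow_lt_one hp0.le hp1 (by linarith)) hp0 hp1
  have h3 : ((qShiftInf p p / qShiftInf (p ^ (α + 1)) p : ℝ) : ℂ) *
      ((qShiftInf (p ^ (α + 1)) p / qShiftInf p p : ℝ) : ℂ) = 1 := by
    rw [← Complex.ofReal_mul]
    have : qShiftInf p p / qShiftInf (p ^ (α + 1)) p *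
      (qShiftInf (p ^ (α + 1)) p / qShiftInf p p) = 1 := by field_simp
    rw [this, Complex.ofReal_one]
  have h4 : z ^ (-(α : ℂ)) * ∑' n : ℕ,
      (-1 : ℂ) ^ n * ((p ^ (n * (n + 1) / 2) : ℝ) : ℂ) * z ^ ((2 * n + α : ℝ) : ℂ) /
        ((qShift p p n * qShift (p ^ (α + 1)) p n : ℝ) : ℂ) = besselModJ α p z := by
    rw [← tsum_mul_left, besselModJ]
    refine tsum_congr fun n => ?_
    have h5 : z ^ (-(α : ℂ)) * z ^ ((2 * n + α : ℝ) : ℂ) = z ^ (2 * n) := by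
      rw [← Complex.cpow_add _ _ hz, ← Complex.cpow_natCast]
      congr 1
      push_cast
      ring
    rw [← h5]
    ring
  rw [besselJ, ← h4]
  linear_combination (-(z ^ (-(α : ℂ)) * ∑' n : ℕ,
      (-1 : ℂ) ^ n * ((p ^ (n * (n + 1) / 2) : ℝ) : ℂ) * z ^ ((2 * n + α : ℝ) : ℂ) /
        ((qShift p p n * qShift (p ^ (α + 1)) p n : ℝ) : ℂ))) * h3

/-- The first positive zero `j_{1,α}^{(3)}` of `J_α^{(3)}(·; q²)`. -/
def besselZero (α q : ℝ) : ℝ := sInf {x : ℝ | 0 < x ∧ besselJ α (q ^ 2) (x : ℂ) = 0}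

/-- `η_{α,1} = q^{1/4} j_{1,α}^{(3)} / (1 - q)`. -/
def eta (α q : ℝ) : ℝ := q ^ (1 / 4 : ℝ) * besselZero α q / (1 - q)

/-- `g_α^{(3)}(t; q) = 𝒥_α^{(3)}((t/2) (1-q) q^{-1/4}; q²)`. -/
def gBessel (α q : ℝ) (t : ℂ) : ℂ :=
  besselModJ α (q ^ 2) (t / 2 * (1 - (q : ℂ)) * ((q ^ (-(1 / 4) : ℝ) : ℝ) : ℂ))

/-- The generating function `exp_q(zt) exp_q(-t/2) / g_α^{(3)}(it; q)`. -/
def genFun (α q : ℝ) (z t : ℂ) : ℂ :=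
  qExp q (z * t) * qExp q (-t / 2) / gBessel α q (I * t)

/-- The generalized `q`-Bernoulli polynomial `B_{n,α}^{(3)}(z; q)`: `[n]_q!` times the `n`-th Taylor
coefficient at `t = 0` of the generating function, so that
`exp_q(zt) exp_q(-t/2) / g_α^{(3)}(it; q) = ∑ B_{n,α}^{(3)}(z; q) t^n / [n]_q!`. -/
def qBernoulli (α q : ℝ) (n : ℕ) (z : ℂ) : ℂ :=
  (qFact q n : ℂ) * (iteratedDeriv n (genFun α q z) 0 / (n.factorial : ℂ))

end QBern

end

/-! The zeros of `𝒥 = 𝒥_α^{(3)}(·; q²)` are real and simple, so the poles of the generating function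
of smallest modulus are the simple poles `±2iη_{α,1}`. By Darboux's method its Taylor coefficients
agree, up to `o((2η_{α,1})^{-n})`, with those of the principal parts at these two poles; as `𝒥'` is
odd, for even and odd `n` the two contributions combine into `CC + SS` and `SC - CS`.

For the zeros write `𝒥(z; p) = F(z²)`. The function `F` satisfies a second-order `p`-difference
equation, and telescoping its Casoratian along `x pⁿ, y pⁿ` expresses `F(x) F(py) - F(px) F(y)` as
`p (y - x)` times a convergent sum, with positive weights, of products `F(x p^k) F(y p^k)` over
`k ≥ 1`. When `y` is the complex conjugate of `x`, these products are squared moduli and the sum is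
positive: a zero `x` must be real, and dividing by `y - x` and letting `y → x` shows that it is
simple. -/

noncomputable section

namespace QBern

open Complex Filter Topology Asymptotics

section PowerSeries

theorem summable_mul_pow_of_succ_eq_mul {𝕜 : Type*} [NormedField 𝕜] [CompleteSpace 𝕜]
    {a c : ℕ → 𝕜} (ha : ∀ n, a (n + 1) = c n * a n) (hc : Tendsto c atTop (𝓝 0)) (z : 𝕜) :
    Summable fun n => a n * z ^ n := by
  have hcz : Tendsto (fun n => ‖c n * z‖) atTop (𝓝 0) := by
    simpa only [zero_mul, norm_zero] using (hc.mul_const z).norm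
  refine summable_of_ratio_norm_eventually_le (r := 1 / 2) (by norm_num) ?_
  filter_upwards [hcz.eventually_le_const (by norm_num : (0 : ℝ) < 1 / 2)] with n hn
  calc ‖a (n + 1) * z ^ (n + 1)‖ = ‖c n * z‖ * ‖a n * z ^ n‖ := by
        rw [← norm_mul, ha]; ring_nf
    _ ≤ 1 / 2 * ‖a n * z ^ n‖ := by gcongr

theorem differentiable_tsum_mul_pow {a : ℕ → ℂ} (ha : ∀ z, Summable fun n => a n * z ^ n) :
    Differentiable ℂ fun z : ℂ => ∑' n, a n * z ^ n := by
  set P := FormalMultilinearSeries.ofScalars (𝕜 := ℂ) ℂ a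
  have hradius : P.radius = ⊤ := P.radius_eq_top_of_summable_norm fun r => by
    simpa [P, FormalMultilinearSeries.ofScalars_norm] using (ha r).norm
  have hsum : P.sum = fun z : ℂ => ∑' n, a n * z ^ n :=
    funext fun z => FormalMultilinearSeries.ofScalars_sum_eq (E := ℂ) a z
  have hP := (P.hasFPowerSeriesOnBall (by simp [hradius])).differentiableOn
  rwa [hradius, Metric.eball_top, differentiableOn_univ, hsum] at hP

end PowerSeries

section Darboux

/-- The `n`-th Taylor coefficient of `f` at the origin. -/
def taylorCoeff (f : ℂ → ℂ) (n : ℕ) : ℂ := iteratedDeriv n f 0 / n.factorial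

theorem taylorCoeff_congr {f g : ℂ → ℂ} (h : f =ᶠ[𝓝 0] g) (n : ℕ) :
    taylorCoeff f n = taylorCoeff g n := by
  rw [taylorCoeff, h.iteratedDeriv_eq, taylorCoeff]

theorem taylorCoeff_add {f g : ℂ → ℂ} (hf : AnalyticAt ℂ f 0) (hg : AnalyticAt ℂ g 0) (n : ℕ) :
    taylorCoeff (fun t => f t + g t) n = taylorCoeff f n + taylorCoeff g n := by
  rw [taylorCoeff, iteratedDeriv_fun_add hf.contDiffAt hg.contDiffAt, add_div, taylorCoeff,
    taylorCoeff]

theorem taylorCoeff_const_div_sub {s : ℂ} (hs : s ≠ 0) (c : ℂ) (n : ℕ) :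
    taylorCoeff (fun t => c / (t - s)) n = -(c / s ^ (n + 1)) := by
  have hderiv := congrFun (iter_deriv_inv_linear_sub n (1 : ℂ) s) 0
  simp only [one_mul, one_pow, mul_one] at hderiv
  have hpow : (0 - s) ^ (-1 - n : ℤ) = (-1) ^ (n + 1) / s ^ (n + 1) := by
    rw [show (-1 - n : ℤ) = -((n + 1 : ℕ) : ℤ) by push_cast; ring, zpow_neg, zpow_natCast, zero_sub,
      neg_pow, mul_inv, ← inv_pow, inv_neg_one, div_eq_mul_inv]
  have hsign : (-1 : ℂ) ^ n * (-1) ^ (n + 1) = -1 := by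
    rw [← pow_add, show n + (n + 1) = 2 * n + 1 by ring, Odd.neg_one_pow ⟨n, rfl⟩]
  have hfact : (n.factorial : ℂ) ≠ 0 := Nat.cast_ne_zero.2 n.factorial_ne_zero
  simp only [taylorCoeff, div_eq_mul_inv c]
  rw [iteratedDeriv_const_mul_field, iteratedDeriv_eq_iterate, hderiv, hpow]
  field_simp
  linear_combination c * hsign

theorem isLittleO_taylorCoeff {f : ℂ → ℂ} {U : Set ℂ} {ρ : ℝ} (hρ : 0 < ρ) (hU : IsOpen U)
    (hρU : Metric.closedBall 0 ρ ⊆ U) (hf : DifferentiableOn ℂ f U) :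
    taylorCoeff f =o[atTop] fun n => (ρ ^ n)⁻¹ := by
  obtain ⟨δ, hδ, hδU⟩ := (isCompact_closedBall (0 : ℂ) ρ).exists_cthickening_subset_open hU hρU
  rw [cthickening_closedBall hδ.le hρ.le] at hδU
  obtain ⟨M, hM⟩ := (isCompact_sphere (0 : ℂ) (δ + ρ)).exists_bound_of_continuousOn
    (hf.continuousOn.mono (Metric.sphere_subset_closedBall.trans hδU))
  have hcauchy : taylorCoeff f =O[atTop] fun n => ((δ + ρ)⁻¹) ^ n :=
    IsBigO.of_bound M <| Eventually.of_forall fun n => by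
      have hn := norm_iteratedDeriv_le_of_forall_mem_sphere_norm_le n (by positivity)
        ((hf.mono hδU).diffContOnCl_ball subset_rfl) hM
      rw [taylorCoeff, norm_div, norm_natCast, div_le_iff₀ (by positivity),
        Real.norm_of_nonneg (by positivity), inv_pow]
      exact hn.trans_eq (by ring)
  simp only [← inv_pow]
  exact hcauchy.trans_isLittleO (isLittleO_pow_pow_of_lt_left (by positivity)
    (inv_strictAnti₀ hρ (by linarith)))

theorem sub_mul_dslope_of_eq_zero {f : ℂ → ℂ} {s : ℂ} (hs : f s = 0) (t : ℂ) :
    (t - s) * dslope f s t = f t := by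
  simpa [hs] using sub_smul_dslope f s t

theorem dslope_eq_zero_of_ne {f : ℂ → ℂ} {s w : ℂ} (hs : f s = 0) (hw : f w = 0) (hws : w ≠ s) :
    dslope f s w = 0 :=
  (mul_eq_zero.1 ((sub_mul_dslope_of_eq_zero hs w).trans hw)).resolve_left (sub_ne_zero.2 hws)

theorem deriv_eq_sub_mul_deriv_dslope {f : ℂ → ℂ} {s w : ℂ} (hf : DifferentiableAt ℂ f w)
    (hs : f s = 0) (hw : f w = 0) (hws : w ≠ s) :
    deriv f w = (w - s) * deriv (dslope f s) w := by
  have hprod := ((hasDerivAt_id' w).sub_const s).mul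
    ((differentiableAt_dslope_of_ne hws).2 hf).hasDerivAt
  rw [dslope_eq_zero_of_ne hs hw hws, mul_zero, zero_add] at hprod
  exact (hprod.congr_of_eventuallyEq
    (.of_forall fun t => (sub_mul_dslope_of_eq_zero hs t).symm)).deriv

/-- The numerator that remains over `dslope G s` when the principal part at a simple zero `s` of `G`
is subtracted from `N / G`; see `div_eq_principalPart_add`. -/
def regularNumerator (N G : ℂ → ℂ) (s : ℂ) : ℂ → ℂ :=
  dslope (fun t => N t - N s / deriv G s * dslope G s t) s

theorem sub_mul_regularNumerator {N G : ℂ → ℂ} {s : ℂ} (hs' : deriv G s ≠ 0) (t : ℂ) :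
    (t - s) * regularNumerator N G s t = N t - N s / deriv G s * dslope G s t :=
  sub_mul_dslope_of_eq_zero (by rw [dslope_same, div_mul_cancel₀ _ hs', sub_self]) t

theorem div_eq_principalPart_add {N G : ℂ → ℂ} {s t : ℂ} (hs : G s = 0) (hs' : deriv G s ≠ 0)
    (hts : t ≠ s) (ht : dslope G s t ≠ 0) :
    N t / G t = N s / deriv G s / (t - s) + regularNumerator N G s t / dslope G s t := by
  have hsub : t - s ≠ 0 := sub_ne_zero.2 hts
  rw [← sub_mul_dslope_of_eq_zero hs t, div_add_div _ _ hsub ht, sub_mul_regularNumerator hs']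
  ring

theorem regularNumerator_div_deriv {N G : ℂ → ℂ} {s w : ℂ} (hG : DifferentiableAt ℂ G w)
    (hs : G s = 0) (hs' : deriv G s ≠ 0) (hw : G w = 0) (hws : w ≠ s) :
    regularNumerator N G s w / deriv (dslope G s) w = N w / deriv G w := by
  have hNw : N w = (w - s) * regularNumerator N G s w := by
    rw [sub_mul_regularNumerator hs', dslope_eq_zero_of_ne hs hw hws, mul_zero, sub_zero]
  rw [hNw, deriv_eq_sub_mul_deriv_dslope hG hs hw hws, mul_div_mul_left _ _ (sub_ne_zero.2 hws)]

theorem differentiableOn_regularNumerator {N G : ℂ → ℂ} {U : Set ℂ} {s : ℂ} (hU : U ∈ 𝓝 s)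
    (hN : DifferentiableOn ℂ N U) (hG : DifferentiableOn ℂ G U) :
    DifferentiableOn ℂ (regularNumerator N G s) U :=
  (differentiableOn_dslope hU).2 (hN.sub (((differentiableOn_dslope hU).2 hG).const_mul _))

theorem taylorCoeff_div_add {N G : ℂ → ℂ} {U : Set ℂ} {s : ℂ} (hU : U ∈ 𝓝 s) (hU0 : U ∈ 𝓝 0)
    (hN : DifferentiableOn ℂ N U) (hG : DifferentiableOn ℂ G U) (hs : G s = 0)
    (hs' : deriv G s ≠ 0) (h0 : G 0 ≠ 0) (n : ℕ) :
    taylorCoeff (fun t => N t / G t) n + N s / deriv G s / s ^ (n + 1) =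
      taylorCoeff (fun t => regularNumerator N G s t / dslope G s t) n := by
  have hs0 : 0 ≠ s := fun h => h0 (h ▸ hs)
  have hG₁ : AnalyticAt ℂ (dslope G s) 0 := ((differentiableOn_dslope hU).2 hG).analyticAt hU0
  have hG₁0 : dslope G s 0 ≠ 0 := by
    rw [← sub_mul_dslope_of_eq_zero hs] at h0
    exact right_ne_zero_of_mul h0
  have hsplit : (fun t => N t / G t) =ᶠ[𝓝 0] fun t =>
      N s / deriv G s / (t - s) + regularNumerator N G s t / dslope G s t := by
    filter_upwards [hG₁.continuousAt.eventually_ne hG₁0, eventually_ne_nhds hs0]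
      with t ht hts using div_eq_principalPart_add hs hs' hts ht
  have hpole : AnalyticAt ℂ (fun t => N s / deriv G s / (t - s)) 0 :=
    analyticAt_const.div (analyticAt_id.sub analyticAt_const) (sub_ne_zero.2 hs0)
  have hregular : AnalyticAt ℂ (fun t => regularNumerator N G s t / dslope G s t) 0 :=
    ((differentiableOn_regularNumerator hU hN hG).analyticAt hU0).div hG₁ hG₁0
  rw [taylorCoeff_congr hsplit, taylorCoeff_add hpole hregular, taylorCoeff_const_div_sub hs0.symm]
  ring

/-- The principal parts are subtracted one pole at a time, which leaves the residues at the
remaining poles unchanged. -/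
theorem isLittleO_taylorCoeff_div_add_sum {N G : ℂ → ℂ} {U : Set ℂ} {S : Finset ℂ} {ρ : ℝ}
    (hρ : 0 < ρ) (hU : IsOpen U) (hρU : Metric.closedBall 0 ρ ⊆ U) (hN : DifferentiableOn ℂ N U)
    (hG : DifferentiableOn ℂ G U) (hSU : ↑S ⊆ U) (hS0 : 0 ∉ S)
    (hS : ∀ s ∈ S, G s = 0 ∧ deriv G s ≠ 0)
    (hzero : ∀ t ∈ Metric.closedBall 0 ρ, G t = 0 → t ∈ S) :
    (fun n => taylorCoeff (fun t => N t / G t) n + ∑ s ∈ S, N s / deriv G s / s ^ (n + 1))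
      =o[atTop] fun n => (ρ ^ n)⁻¹ := by
  induction S using Finset.induction_on generalizing N G with
  | empty =>
    simp only [Finset.sum_empty, add_zero]
    refine isLittleO_taylorCoeff hρ (hG.continuousOn.isOpen_inter_preimage hU isOpen_ne)
      (fun t ht => ⟨hρU ht, fun h => Finset.notMem_empty t (hzero t ht h)⟩)
      ((hN.mono Set.inter_subset_left).div (hG.mono Set.inter_subset_left) fun t ht => ht.2)
  | insert s S hsS ih =>
    have h0 : (0 : ℂ) ∈ Metric.closedBall 0 ρ := Metric.mem_closedBall_self hρ.le
    have hG0 : G 0 ≠ 0 := fun h => hS0 (hzero 0 h0 h)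
    rw [Finset.coe_insert, Set.insert_subset_iff] at hSU
    rw [Finset.forall_mem_insert] at hS
    obtain ⟨⟨hsU, hSU⟩, ⟨hs, hs'⟩, hS⟩ := And.intro hSU hS
    have hUs : U ∈ 𝓝 s := hU.mem_nhds hsU
    have hne {w : ℂ} (hw : w ∈ S) : w ≠ s := fun h => hsS (h ▸ hw)
    have hGw {w : ℂ} (hw : w ∈ S) : DifferentiableAt ℂ G w :=
      hG.differentiableAt (hU.mem_nhds (hSU hw))
    have hS₁ (w : ℂ) (hw : w ∈ S) : dslope G s w = 0 ∧ deriv (dslope G s) w ≠ 0 := by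
      obtain ⟨hw0, hw'⟩ := hS w hw
      rw [deriv_eq_sub_mul_deriv_dslope (hGw hw) hs hw0 (hne hw)] at hw'
      exact ⟨dslope_eq_zero_of_ne hs hw0 (hne hw), right_ne_zero_of_mul hw'⟩
    have hzero₁ (t : ℂ) (ht : t ∈ Metric.closedBall 0 ρ) (h : dslope G s t = 0) : t ∈ S := by
      have hGt : G t = 0 := by rw [← sub_mul_dslope_of_eq_zero hs, h, mul_zero]
      refine (Finset.mem_insert.1 (hzero t ht hGt)).resolve_left ?_
      rintro rfl
      exact hs' (by rwa [dslope_same] at h)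
    refine (ih (differentiableOn_regularNumerator hUs hN hG) ((differentiableOn_dslope hUs).2 hG)
      hSU (fun h => hS0 (Finset.mem_insert_of_mem h)) hS₁ hzero₁).congr_left fun n => ?_
    rw [Finset.sum_insert hsS, ← add_assoc,
      taylorCoeff_div_add hUs (hU.mem_nhds (hρU h0)) hN hG hs hs' hG0]
    exact congrArg _ (Finset.sum_congr rfl fun w hw => by
      rw [regularNumerator_div_deriv (hGw hw) hs hs' (hS w hw).1 (hne hw)])

theorem isLittleO_ofReal_mul_comp {e : ℕ → ℂ} {r ρ : ℝ} (c : ℕ → ℝ) (hr : 0 < r) (hrρ : r ≤ ρ)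
    (he : e =o[atTop] fun n => (ρ ^ n)⁻¹) (k : ℕ) :
    (fun n => (c n : ℂ) * e (2 * n + k)) =o[atTop] fun n => c n * (r ^ (2 * n))⁻¹ := by
  have hρ : 0 < ρ := hr.trans_le hrρ
  have hsub : Tendsto (fun n : ℕ => 2 * n + k) atTop atTop :=
    tendsto_atTop_mono (fun n => show n ≤ 2 * n + k by omega) tendsto_id
  have hpow : (fun n : ℕ => (ρ ^ (2 * n + k))⁻¹) =O[atTop] fun n => (r ^ (2 * n))⁻¹ :=
    IsBigO.of_bound (ρ ^ k)⁻¹ <| Eventually.of_forall fun n => by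
      rw [Real.norm_of_nonneg (by positivity), Real.norm_of_nonneg (by positivity), pow_add,
        mul_inv, mul_comm]
      gcongr
  have hc : (fun n => (c n : ℂ)) =O[atTop] c := isBigO_of_le atTop fun n => (norm_real _).le
  exact hc.mul_isLittleO ((he.comp_tendsto hsub).trans_isBigO hpow)

end Darboux

section QExponential

theorem qShift_succ (a q : ℝ) (n : ℕ) : qShift a q (n + 1) = qShift a q n * (1 - a * q ^ n) :=
  Finset.prod_range_succ _ n

theorem one_sub_mul_pow_pos {a q : ℝ} (ha1 : a < 1) (hq0 : 0 < q) (hq1 : q < 1) (n : ℕ) :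
    0 < 1 - a * q ^ n := by
  have hle : q ^ n ≤ 1 := pow_le_one₀ hq0.le hq1.le
  have hmul : 0 < (1 - a) * q ^ n := mul_pos (sub_pos.2 ha1) (pow_pos hq0 n)
  linarith

theorem qShift_pos {a q : ℝ} (ha1 : a < 1) (hq0 : 0 < q) (hq1 : q < 1) (n : ℕ) :
    0 < qShift a q n :=
  Finset.prod_pos fun k _ => one_sub_mul_pow_pos ha1 hq0 hq1 k

theorem tendsto_one_sub_mul_pow (a : ℝ) {q : ℝ} (hq0 : 0 < q) (hq1 : q < 1) :
    Tendsto (fun n : ℕ => 1 - a * q ^ n) atTop (𝓝 1) := by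
  simpa using ((tendsto_pow_atTop_nhds_zero_of_lt_one hq0.le hq1).const_mul a).const_sub 1

theorem rpow_triangular_succ {q : ℝ} (hq0 : 0 < q) (n : ℕ) :
    q ^ (((n + 1 : ℕ) : ℝ) * (((n + 1 : ℕ) : ℝ) - 1) / 4) =
      (q ^ (1 / 2 : ℝ)) ^ n * q ^ ((n : ℝ) * ((n : ℝ) - 1) / 4) := by
  rw [← Real.rpow_natCast, ← Real.rpow_mul hq0.le, ← Real.rpow_add hq0]
  congr 1
  push_cast
  ring

theorem differentiable_qExp {q : ℝ} (hq0 : 0 < q) (hq1 : q < 1) : Differentiable ℂ (qExp q) := by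
  set c : ℕ → ℝ := fun n => (q ^ (1 / 2 : ℝ)) ^ n / (1 - q * q ^ n)
  have hc : Tendsto c atTop (𝓝 0) := by
    rw [← zero_div (1 : ℝ)]
    exact (tendsto_pow_atTop_nhds_zero_of_lt_one (by positivity)
      (Real.rpow_lt_one hq0.le hq1 one_half_pos)).div
      (tendsto_one_sub_mul_pow q hq0 hq1) one_ne_zero
  have hratio (n : ℕ) : q ^ (((n + 1 : ℕ) : ℝ) * (((n + 1 : ℕ) : ℝ) - 1) / 4) / qShift q q (n + 1) =
      c n * (q ^ ((n : ℝ) * ((n : ℝ) - 1) / 4) / qShift q q n) := by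
    rw [rpow_triangular_succ hq0, qShift_succ, mul_comm (qShift q q n), mul_div_mul_comm]
  have hentire := differentiable_tsum_mul_pow (summable_mul_pow_of_succ_eq_mul
    (a := fun n : ℕ => ((q ^ ((n : ℝ) * ((n : ℝ) - 1) / 4) / qShift q q n : ℝ) : ℂ))
    (c := fun n => (c n : ℂ)) (fun n => by rw [hratio, ofReal_mul])
    (by simpa only [ofReal_zero] using hc.ofReal))
  exact hentire.comp (f := fun z : ℂ => z * (1 - (q : ℂ))) (by fun_prop)

theorem qCos_mul_add_qSin_mul (q : ℝ) (x y : ℂ) :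
    qCos q x * qCos q y + qSin q x * qSin q y =
      (qExp q (I * x) * qExp q (-(I * y)) + qExp q (-(I * x)) * qExp q (I * y)) / 2 := by
  simp only [qCos, qSin]
  field_simp
  linear_combination (qExp q (I * x) - qExp q (-(I * x))) *
    (qExp q (I * y) - qExp q (-(I * y))) * I_sq

theorem qSin_mul_sub_qCos_mul (q : ℝ) (x y : ℂ) :
    qSin q x * qCos q y - qCos q x * qSin q y =
      (qExp q (I * x) * qExp q (-(I * y)) - qExp q (-(I * x)) * qExp q (I * y)) / (2 * I) := by
  simp only [qCos, qSin]
  field_simp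
  ring

end QExponential

section HahnExton

variable {b p : ℝ}

/-- The coefficients of the basic hypergeometric series `₁φ₁(0; b; p, p x)`. -/
def hahnExtonCoeff (b p : ℝ) (n : ℕ) : ℝ :=
  (-1) ^ n * p ^ (n * (n + 1) / 2) / (qShift p p n * qShift b p n)

/-- The entire function `₁φ₁(0; b; p, p x)`, whose value at `b = p^{α+1}` and `x = z²` is
`𝒥_α^{(3)}(z; p)`. -/
def hahnExton (b p : ℝ) (x : ℂ) : ℂ := ∑' n : ℕ, (hahnExtonCoeff b p n : ℂ) * x ^ n

theorem hahnExtonCoeff_zero : hahnExtonCoeff b p 0 = 1 := by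
  simp [hahnExtonCoeff, qShift]

theorem hahnExtonCoeff_succ (b p : ℝ) (n : ℕ) :
    hahnExtonCoeff b p (n + 1) =
      -(p ^ (n + 1) / ((1 - p * p ^ n) * (1 - b * p ^ n))) * hahnExtonCoeff b p n := by
  have htriangle : (n + 1) * (n + 1 + 1) / 2 = (n + 1) + n * (n + 1) / 2 := by
    rw [show (n + 1) * (n + 1 + 1) = 2 * (n + 1) + n * (n + 1) by ring,
      Nat.mul_add_div two_pos]
  rw [hahnExtonCoeff, hahnExtonCoeff, htriangle, qShift_succ, qShift_succ, pow_add p,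
    pow_succ (-1 : ℝ), ← neg_div, div_mul_div_comm]
  congr 1 <;> ring

theorem summable_hahnExton (b : ℝ) (hp0 : 0 < p) (hp1 : p < 1) (x : ℂ) :
    Summable fun n : ℕ => (hahnExtonCoeff b p n : ℂ) * x ^ n := by
  have hc : Tendsto (fun n : ℕ => -(p ^ (n + 1) / ((1 - p * p ^ n) * (1 - b * p ^ n)))) atTop
      (𝓝 0) := by
    simpa using ((((tendsto_pow_atTop_nhds_zero_of_lt_one hp0.le hp1).comp
      (tendsto_add_atTop_nat 1)).div ((tendsto_one_sub_mul_pow p hp0 hp1).mul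
        (tendsto_one_sub_mul_pow b hp0 hp1)) (by norm_num)).neg)
  refine summable_mul_pow_of_succ_eq_mul (fun n => ?_)
    (by simpa only [ofReal_zero] using hc.ofReal) x
  rw [hahnExtonCoeff_succ, ofReal_mul]

theorem differentiable_hahnExton (b : ℝ) (hp0 : 0 < p) (hp1 : p < 1) :
    Differentiable ℂ (hahnExton b p) :=
  differentiable_tsum_mul_pow (summable_hahnExton b hp0 hp1)

theorem hahnExton_zero : hahnExton b p 0 = 1 := by
  rw [hahnExton, tsum_eq_single 0 fun n hn => by rw [zero_pow hn, mul_zero], hahnExtonCoeff_zero,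
    ofReal_one, pow_zero, one_mul]

theorem hahnExton_ofReal (x : ℝ) :
    hahnExton b p x = ((∑' n : ℕ, hahnExtonCoeff b p n * x ^ n : ℝ) : ℂ) := by
  rw [hahnExton, ofReal_tsum]
  push_cast
  rfl

theorem hahnExton_conj (x : ℂ) :
    hahnExton b p ((starRingEnd ℂ) x) = (starRingEnd ℂ) (hahnExton b p x) := by
  rw [hahnExton, hahnExton, conj_tsum]
  simp only [map_mul, map_pow, conj_ofReal]

theorem hahnExton_difference (hb1 : b < 1) (hp0 : 0 < p) (hp1 : p < 1) (x : ℂ) :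
    p * hahnExton b p x = (p + b - p ^ 2 * x) * hahnExton b p (p * x) -
      b * hahnExton b p (p ^ 2 * x) := by
  have hF (y : ℂ) := (summable_hahnExton b hp0 hp1 y).hasSum
  have hcoeff (n : ℕ) : (hahnExtonCoeff b p (n + 1) : ℂ) * ((1 - p * p ^ n) * (1 - b * p ^ n)) =
      -(p ^ (n + 1) * hahnExtonCoeff b p n) := by
    have hb := (one_sub_mul_pow_pos hb1 hp0 hp1 n).ne'
    have hp := (one_sub_mul_pow_pos hp1 hp0 hp1 n).ne'
    have hreal : hahnExtonCoeff b p (n + 1) * ((1 - p * p ^ n) * (1 - b * p ^ n)) =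
        -(p ^ (n + 1) * hahnExtonCoeff b p n) := by
      rw [hahnExtonCoeff_succ, neg_mul, neg_mul, mul_right_comm,
        div_mul_cancel₀ _ (mul_ne_zero hp hb)]
    exact_mod_cast hreal
  have hterm (n : ℕ) : -((p : ℂ) ^ 2 * x) * ((hahnExtonCoeff b p n : ℂ) * (p * x) ^ n) =
      p * ((hahnExtonCoeff b p (n + 1) : ℂ) * x ^ (n + 1)) -
        (p + b) * ((hahnExtonCoeff b p (n + 1) : ℂ) * (p * x) ^ (n + 1)) +
        b * ((hahnExtonCoeff b p (n + 1) : ℂ) * (p ^ 2 * x) ^ (n + 1)) := by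
    simp only [mul_pow, ← pow_mul]
    linear_combination (-(p : ℂ) * x ^ (n + 1)) * hcoeff n
  have hshift := (hasSum_nat_add_iff' 1).2
    ((((hF x).mul_left (p : ℂ)).sub ((hF (p * x)).mul_left (p + b : ℂ))).add
      ((hF (p ^ 2 * x)).mul_left (b : ℂ)))
  have hsum := (funext hterm ▸ (hF (p * x)).mul_left (-(p ^ 2 * x) : ℂ)).unique hshift
  simp only [Finset.range_one, Finset.sum_singleton, pow_zero, hahnExtonCoeff_zero,
    ofReal_one] at hsum
  simp only [hahnExton]
  linear_combination -hsum

theorem hahnExton_ne_zero_of_nonpos (hb1 : b < 1) (hp0 : 0 < p) (hp1 : p < 1)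
    {x : ℝ} (hx : x ≤ 0) : hahnExton b p x ≠ 0 := by
  have hsum : Summable fun n : ℕ => hahnExtonCoeff b p n * x ^ n := by
    exact_mod_cast summable_hahnExton b hp0 hp1 x
  have hnonneg (n : ℕ) : 0 ≤ hahnExtonCoeff b p n * x ^ n := by
    have hterm : hahnExtonCoeff b p n * x ^ n =
        p ^ (n * (n + 1) / 2) / (qShift p p n * qShift b p n) * (-x) ^ n := by
      rw [hahnExtonCoeff, neg_pow x]
      ring
    have hb := qShift_pos hb1 hp0 hp1 n
    have hp := qShift_pos hp1 hp0 hp1 n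
    rw [hterm]
    exact mul_nonneg (by positivity) (pow_nonneg (neg_nonneg.2 hx) n)
  have hone : 1 ≤ ∑' n : ℕ, hahnExtonCoeff b p n * x ^ n := by
    simpa [hahnExtonCoeff_zero] using hsum.le_tsum 0 fun n _ => hnonneg n
  rw [hahnExton_ofReal]
  exact ofReal_ne_zero.2 (by linarith)

/-- If there were no positive zero, the function would be positive on `[0, ∞)`. At
`x = (p + b) / p²` the difference equation reads `p F(x) = -b F(p² x)`. -/
theorem exists_pos_hahnExton_eq_zero (hb0 : 0 < b) (hb1 : b < 1) (hp0 : 0 < p) (hp1 : p < 1) :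
    ∃ x : ℝ, 0 < x ∧ hahnExton b p x = 0 := by
  set φ : ℝ → ℝ := fun x => ∑' n : ℕ, hahnExtonCoeff b p n * x ^ n
  have hφ (x : ℝ) : hahnExton b p x = φ x := hahnExton_ofReal x
  have hcont : Continuous φ :=
    (continuous_re.comp ((differentiable_hahnExton b hp0 hp1).continuous.comp
      continuous_ofReal)).congr fun x => (congrArg re (hφ x)).trans (ofReal_re _)
  have hφ0 : φ 0 = 1 := by
    rw [← ofReal_inj, ← hφ, ofReal_zero, hahnExton_zero, ofReal_one]
  suffices h : ∃ x, 0 < x ∧ φ x ≤ 0 by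
    obtain ⟨x, hx, hφx⟩ := h
    obtain ⟨y, hy, hφy⟩ := intermediate_value_Icc' hx.le hcont.continuousOn
      ⟨hφx, zero_le_one.trans_eq hφ0.symm⟩
    have hy0 : 0 ≠ y := by
      rintro rfl
      exact one_ne_zero (hφ0.symm.trans hφy)
    exact ⟨y, hy.1.lt_of_ne hy0, by rw [hφ, hφy, ofReal_zero]⟩
  by_contra! hpos
  have hdiff : (p : ℂ) * hahnExton b p ((p + b) / p ^ 2 : ℝ) =
      -(b * hahnExton b p (p ^ 2 * ((p + b) / p ^ 2 : ℝ) : ℝ)) := by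
    have hp : (p : ℂ) ≠ 0 := ofReal_ne_zero.2 hp0.ne'
    have h := hahnExton_difference hb1 hp0 hp1 ((p + b) / p ^ 2 : ℝ)
    push_cast at h ⊢
    rw [h, mul_div_cancel₀ _ (pow_ne_zero 2 hp), sub_self, zero_mul, zero_sub]
  rw [hφ, hφ] at hdiff
  have hreal : p * φ ((p + b) / p ^ 2) = -(b * φ (p ^ 2 * ((p + b) / p ^ 2))) := by
    exact_mod_cast hdiff
  have hleft := mul_pos hp0 (hpos ((p + b) / p ^ 2) (by positivity))
  have hright := mul_pos hb0 (hpos (p ^ 2 * ((p + b) / p ^ 2)) (by positivity))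
  linarith

theorem tendsto_ofReal_pow_atTop_nhds_zero {r : ℝ} (hr0 : 0 ≤ r) (hr1 : r < 1) :
    Tendsto (fun n : ℕ => (r : ℂ) ^ n) atTop (𝓝 0) :=
  tendsto_pow_atTop_nhds_zero_of_norm_lt_one (by rwa [norm_real, Real.norm_of_nonneg hr0])

theorem tendsto_hahnExton_pow_mul (b : ℝ) (hp0 : 0 < p) (hp1 : p < 1) (x : ℂ) :
    Tendsto (fun n : ℕ => hahnExton b p (p ^ n * x)) atTop (𝓝 1) := by
  have hpow : Tendsto (fun n : ℕ => (p : ℂ) ^ n * x) atTop (𝓝 0) := by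
    simpa only [zero_mul] using (tendsto_ofReal_pow_atTop_nhds_zero hp0.le hp1).mul_const x
  have hcont := (differentiable_hahnExton b hp0 hp1).continuous.tendsto 0
  rw [hahnExton_zero] at hcont
  exact hcont.comp hpow

/-- The Casoratian of the solutions `k ↦ ₁φ₁(0; b; p, p^{k+1} x)` and `k ↦ ₁φ₁(0; b; p, p^{k+1} y)`
of two second order recurrences, at `k = 0`. -/
def hahnExtonCasoratian (b p : ℝ) (x y : ℂ) : ℂ :=
  hahnExton b p x * hahnExton b p (p * y) - hahnExton b p (p * x) * hahnExton b p y

/-- The Christoffel–Darboux type kernel of the functions `₁φ₁(0; b; p, p^{k+1} x)`, in which the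
weight `b^k` makes the recurrence in `k` symmetric. -/
def hahnExtonKernel (b p : ℝ) (x y : ℂ) : ℂ :=
  ∑' k : ℕ, (b : ℂ) ^ k * (hahnExton b p (p ^ (k + 1) * x) * hahnExton b p (p ^ (k + 1) * y))

theorem exists_norm_hahnExtonKernel_term_le (hb0 : 0 < b) (hp0 : 0 < p) (hp1 : p < 1) (R : ℝ) :
    ∃ M : ℝ, ∀ x y : ℂ, ‖x‖ ≤ R → ‖y‖ ≤ R → ∀ k : ℕ,
      ‖(b : ℂ) ^ k * (hahnExton b p (p ^ (k + 1) * x) * hahnExton b p (p ^ (k + 1) * y))‖ ≤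
        b ^ k * (M * M) := by
  obtain ⟨M, hM⟩ := (isCompact_closedBall (0 : ℂ) R).exists_bound_of_continuousOn
    (differentiable_hahnExton b hp0 hp1).continuous.continuousOn
  have hbound {x : ℂ} (hx : ‖x‖ ≤ R) (k : ℕ) : ‖hahnExton b p (p ^ (k + 1) * x)‖ ≤ M := by
    refine hM _ (mem_closedBall_zero_iff.2 (le_trans ?_ hx))
    rw [norm_mul, norm_pow, norm_real, Real.norm_of_nonneg hp0.le]
    exact mul_le_of_le_one_left (norm_nonneg x) (pow_le_one₀ hp0.le hp1.le)
  refine ⟨M, fun x y hx hy k => ?_⟩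
  rw [norm_mul, norm_mul, norm_pow, norm_real, Real.norm_of_nonneg hb0.le]
  gcongr
  · exact (norm_nonneg _).trans (hbound hx k)
  · exact hbound hx k
  · exact hbound hy k

theorem summable_hahnExtonKernel (hb0 : 0 < b) (hb1 : b < 1) (hp0 : 0 < p) (hp1 : p < 1)
    (x y : ℂ) : Summable fun k : ℕ =>
      (b : ℂ) ^ k * (hahnExton b p (p ^ (k + 1) * x) * hahnExton b p (p ^ (k + 1) * y)) := by
  obtain ⟨M, hM⟩ := exists_norm_hahnExtonKernel_term_le hb0 hp0 hp1 (max ‖x‖ ‖y‖)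
  exact ((summable_geometric_of_lt_one hb0.le hb1).mul_right (M * M)).of_norm_bounded
    (hM x y (le_max_left _ _) (le_max_right _ _))

theorem differentiable_hahnExtonKernel (hb0 : 0 < b) (hb1 : b < 1) (hp0 : 0 < p) (hp1 : p < 1)
    (x : ℂ) : Differentiable ℂ (hahnExtonKernel b p x) := fun y => by
  set R := max ‖x‖ (‖y‖ + 1)
  obtain ⟨M, hM⟩ := exists_norm_hahnExtonKernel_term_le hb0 hp0 hp1 R
  have hF := differentiable_hahnExton b hp0 hp1
  have hdiff : DifferentiableOn ℂ (hahnExtonKernel b p x) (Metric.ball 0 R) :=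
    differentiableOn_tsum_of_summable_norm
      ((summable_geometric_of_lt_one hb0.le hb1).mul_right (M * M))
      (fun k => by fun_prop) Metric.isOpen_ball
      fun k w hw => hM x w (le_max_left _ _) (mem_ball_zero_iff.1 hw).le k
  exact hdiff.differentiableAt (Metric.isOpen_ball.mem_nhds
    (mem_ball_zero_iff.2 ((lt_add_one _).trans_le (le_max_right _ _))))

theorem hahnExtonCasoratian_eq_add (hb1 : b < 1) (hp0 : 0 < p) (hp1 : p < 1) (x y : ℂ) :
    hahnExtonCasoratian b p x y =
      p * (y - x) * (hahnExton b p (p * x) * hahnExton b p (p * y)) +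
        b / p * hahnExtonCasoratian b p (p * x) (p * y) := by
  have hp : (p : ℂ) ≠ 0 := ofReal_ne_zero.2 hp0.ne'
  have hx := hahnExton_difference hb1 hp0 hp1 x
  have hy := hahnExton_difference hb1 hp0 hp1 y
  refine mul_left_cancel₀ hp ?_
  rw [mul_add, ← mul_assoc (p : ℂ) (b / p), mul_div_cancel₀ _ hp]
  simp only [hahnExtonCasoratian, ← mul_assoc, ← sq]
  linear_combination hahnExton b p (p * y) * hx - hahnExton b p (p * x) * hy

theorem hahnExtonCasoratian_eq_sum_add (hb1 : b < 1) (hp0 : 0 < p) (hp1 : p < 1) (x y : ℂ)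
    (n : ℕ) : hahnExtonCasoratian b p x y =
      p * (y - x) * (∑ k ∈ Finset.range n,
        (b : ℂ) ^ k * (hahnExton b p (p ^ (k + 1) * x) * hahnExton b p (p ^ (k + 1) * y))) +
      (b / p : ℂ) ^ n * hahnExtonCasoratian b p (p ^ n * x) (p ^ n * y) := by
  have hp : (p : ℂ) ≠ 0 := ofReal_ne_zero.2 hp0.ne'
  induction n with
  | zero => simp only [Finset.range_zero, Finset.sum_empty, pow_zero, one_mul, mul_zero, zero_add]
  | succ n ih =>
    have hstep := hahnExtonCasoratian_eq_add hb1 hp0 hp1 (p ^ n * x) (p ^ n * y)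
    have hratio : (b / p : ℂ) ^ n * p ^ n = b ^ n := by rw [← mul_pow, div_mul_cancel₀ _ hp]
    rw [← mul_assoc (p : ℂ), ← mul_assoc (p : ℂ), ← pow_succ'] at hstep
    rw [ih, Finset.sum_range_succ, hstep, ← hratio]
    ring

theorem tendsto_div_pow_mul_hahnExtonCasoratian (hb0 : 0 < b) (hb1 : b < 1) (hp0 : 0 < p)
    (hp1 : p < 1) (x y : ℂ) :
    Tendsto (fun n : ℕ => (b / p : ℂ) ^ n * hahnExtonCasoratian b p (p ^ n * x) (p ^ n * y)) atTop
      (𝓝 0) := by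
  have hp : (p : ℂ) ≠ 0 := ofReal_ne_zero.2 hp0.ne'
  have hF := differentiable_hahnExton b hp0 hp1
  have hdiff : DifferentiableAt ℂ (fun t : ℂ => hahnExtonCasoratian b p (t * x) (t * y)) 0 := by
    unfold hahnExtonCasoratian
    fun_prop
  have hlinear : (fun t : ℂ => hahnExtonCasoratian b p (t * x) (t * y)) =O[𝓝 0] fun t => t := by
    simpa [hahnExtonCasoratian, hahnExton_zero] using hdiff.isBigO_sub
  have hpow : Tendsto (fun n : ℕ => (p : ℂ) ^ n) atTop (𝓝 0) :=
    tendsto_ofReal_pow_atTop_nhds_zero hp0.le hp1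
  have hgeom : Tendsto (fun n : ℕ => (b / p : ℂ) ^ n * p ^ n) atTop (𝓝 0) := by
    simp only [← mul_pow, div_mul_cancel₀ _ hp]
    exact tendsto_ofReal_pow_atTop_nhds_zero hb0.le hb1
  exact ((isBigO_refl _ _).mul (hlinear.comp_tendsto hpow)).trans_tendsto hgeom

theorem hahnExtonCasoratian_eq (hb0 : 0 < b) (hb1 : b < 1) (hp0 : 0 < p) (hp1 : p < 1) (x y : ℂ) :
    hahnExtonCasoratian b p x y = p * (y - x) * hahnExtonKernel b p x y := by
  have hlim := ((summable_hahnExtonKernel hb0 hb1 hp0 hp1 x y).hasSum.tendsto_sum_nat.const_mul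
    (p * (y - x) : ℂ)).add (tendsto_div_pow_mul_hahnExtonCasoratian hb0 hb1 hp0 hp1 x y)
  simp only [← hahnExtonCasoratian_eq_sum_add hb1 hp0 hp1 x y, add_zero] at hlim
  exact tendsto_nhds_unique tendsto_const_nhds hlim

theorem hahnExtonKernel_conj_ne_zero (hb0 : 0 < b) (hb1 : b < 1) (hp0 : 0 < p) (hp1 : p < 1)
    (x : ℂ) : hahnExtonKernel b p x ((starRingEnd ℂ) x) ≠ 0 := by
  have hterm (k : ℕ) : (b : ℂ) ^ k * (hahnExton b p (p ^ (k + 1) * x) *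
      hahnExton b p (p ^ (k + 1) * (starRingEnd ℂ) x)) =
      (b ^ k * normSq (hahnExton b p (p ^ (k + 1) * x)) : ℝ) := by
    rw [show (p : ℂ) ^ (k + 1) * (starRingEnd ℂ) x = (starRingEnd ℂ) (p ^ (k + 1) * x) by
      rw [map_mul, map_pow, conj_ofReal], hahnExton_conj, mul_conj, ofReal_mul, ofReal_pow]
  have hsum : Summable fun k : ℕ => b ^ k * normSq (hahnExton b p (p ^ (k + 1) * x)) := by
    simpa only [hterm, summable_ofReal] using
      summable_hahnExtonKernel hb0 hb1 hp0 hp1 x ((starRingEnd ℂ) x)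
  obtain ⟨k, hk⟩ := (((tendsto_hahnExton_pow_mul b hp0 hp1 x).comp
    (tendsto_add_atTop_nat 1)).eventually_ne one_ne_zero).exists
  rw [hahnExtonKernel, tsum_congr hterm, ← ofReal_tsum]
  exact ofReal_ne_zero.2 (hsum.tsum_pos (fun n => mul_nonneg (by positivity) (normSq_nonneg _)) k
    (mul_pos (by positivity) (normSq_pos.2 hk))).ne'

theorem conj_eq_of_hahnExton_eq_zero (hb0 : 0 < b) (hb1 : b < 1) (hp0 : 0 < p) (hp1 : p < 1)
    {x : ℂ} (hx : hahnExton b p x = 0) : (starRingEnd ℂ) x = x := by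
  have h := hahnExtonCasoratian_eq hb0 hb1 hp0 hp1 x ((starRingEnd ℂ) x)
  rw [hahnExtonCasoratian, hahnExton_conj, hx, map_zero, zero_mul, mul_zero, sub_zero, eq_comm,
    mul_eq_zero, or_iff_left (hahnExtonKernel_conj_ne_zero hb0 hb1 hp0 hp1 x), mul_eq_zero,
    or_iff_right (ofReal_ne_zero.2 hp0.ne')] at h
  exact sub_eq_zero.1 h

/-- On the diagonal, the kernel identity becomes `p K(x, x) = -F(p x) F'(x)` at a zero `x` of
`F = ₁φ₁(0; b; p, p ·)`. -/
theorem deriv_hahnExton_ne_zero (hb0 : 0 < b) (hb1 : b < 1) (hp0 : 0 < p) (hp1 : p < 1)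
    {x : ℂ} (hx : hahnExton b p x = 0) : deriv (hahnExton b p) x ≠ 0 := fun hderiv => by
  have hcas : hahnExtonCasoratian b p x = fun y => -hahnExton b p (p * x) * hahnExton b p y := by
    funext y
    rw [hahnExtonCasoratian, hx, zero_mul, zero_sub, neg_mul]
  have hleft : HasDerivAt (hahnExtonCasoratian b p x) 0 x := by
    rw [hcas]
    simpa only [hderiv, mul_zero] using
      (differentiable_hahnExton b hp0 hp1 x).hasDerivAt.const_mul (-hahnExton b p (p * x))
  have hright := (((hasDerivAt_id' x).sub_const x).const_mul (p : ℂ)).mul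
    (differentiable_hahnExtonKernel hb0 hb1 hp0 hp1 x x).hasDerivAt
  rw [sub_self, mul_zero, zero_mul, add_zero, mul_one] at hright
  have hdiag : (p : ℂ) * hahnExtonKernel b p x x = 0 :=
    (hright.congr_of_eventuallyEq (.of_forall (hahnExtonCasoratian_eq hb0 hb1 hp0 hp1 x))).unique
      hleft
  refine hahnExtonKernel_conj_ne_zero hb0 hb1 hp0 hp1 x ?_
  rw [conj_eq_of_hahnExton_eq_zero hb0 hb1 hp0 hp1 hx]
  exact (mul_eq_zero.1 hdiag).resolve_left (ofReal_ne_zero.2 hp0.ne')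

end HahnExton

section BesselZeros

variable {α p q : ℝ}

theorem rpow_add_one_mem_Ioo (hα : -1 < α) (hp0 : 0 < p) (hp1 : p < 1) :
    p ^ (α + 1) ∈ Set.Ioo (0 : ℝ) 1 :=
  ⟨Real.rpow_pos_of_pos hp0 _, Real.rpow_lt_one hp0.le hp1 (by linarith)⟩

theorem besselModJ_eq_hahnExton (α p : ℝ) (z : ℂ) :
    besselModJ α p z = hahnExton (p ^ (α + 1)) p (z ^ 2) := by
  refine tsum_congr fun n => ?_
  rw [hahnExtonCoeff, ← pow_mul]
  push_cast
  ring

theorem hasDerivAt_besselModJ (α : ℝ) (hp0 : 0 < p) (hp1 : p < 1) (z : ℂ) :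
    HasDerivAt (besselModJ α p) (deriv (hahnExton (p ^ (α + 1)) p) (z ^ 2) * (2 * z)) z := by
  rw [funext (besselModJ_eq_hahnExton α p)]
  have hsq : HasDerivAt (fun w : ℂ => w ^ 2) (2 * z) z := by simpa using hasDerivAt_pow 2 z
  exact (differentiable_hahnExton (p ^ (α + 1)) hp0 hp1 (z ^ 2)).hasDerivAt.comp z hsq

theorem differentiable_besselModJ (α : ℝ) (hp0 : 0 < p) (hp1 : p < 1) :
    Differentiable ℂ (besselModJ α p) := fun z =>
  (hasDerivAt_besselModJ α hp0 hp1 z).differentiableAt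

theorem besselModJ_zero : besselModJ α p 0 = 1 := by
  rw [besselModJ_eq_hahnExton, zero_pow two_ne_zero, hahnExton_zero]

theorem besselModJ_neg (α p : ℝ) (z : ℂ) : besselModJ α p (-z) = besselModJ α p z := by
  rw [besselModJ_eq_hahnExton, neg_sq, ← besselModJ_eq_hahnExton]

theorem deriv_besselModJ_neg (α p : ℝ) (z : ℂ) :
    deriv (besselModJ α p) (-z) = -deriv (besselModJ α p) z := by
  rw [← neg_eq_iff_eq_neg, ← deriv_comp_neg]
  simp only [besselModJ_neg]

theorem besselJ_eq_zero_iff (hα : -1 < α) (hp0 : 0 < p) (hp1 : p < 1) {z : ℂ} (hz : z ≠ 0) :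
    besselJ α p z = 0 ↔ besselModJ α p z = 0 := by
  obtain ⟨hb0, hb1⟩ := rpow_add_one_mem_Ioo hα hp0 hp1
  have hconst : ((qShiftInf p p / qShiftInf (p ^ (α + 1)) p : ℝ) : ℂ) ≠ 0 :=
    ofReal_ne_zero.2 (div_ne_zero (qShiftInf_ne_zero hp0 hp1 hp0 hp1)
      (qShiftInf_ne_zero hb0 hb1 hp0 hp1))
  rw [besselModJ_eq hα hp0 hp1 hz, mul_eq_zero, or_iff_right]
  exact mul_ne_zero hconst (by simp [cpow_eq_zero_iff, hz])

theorem exists_ofReal_of_besselModJ_eq_zero (hα : -1 < α) (hp0 : 0 < p) (hp1 : p < 1) {z : ℂ}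
    (hz : besselModJ α p z = 0) : ∃ x : ℝ, x ≠ 0 ∧ z = x := by
  obtain ⟨hb0, hb1⟩ := rpow_add_one_mem_Ioo hα hp0 hp1
  rw [besselModJ_eq_hahnExton] at hz
  obtain ⟨y, hy⟩ := conj_eq_iff_real.1 (conj_eq_of_hahnExton_eq_zero hb0 hb1 hp0 hp1 hz)
  have hypos : 0 < y := by
    by_contra! hle
    exact hahnExton_ne_zero_of_nonpos hb1 hp0 hp1 hle (hy ▸ hz)
  have hsq : z ^ 2 = (√y : ℝ) ^ 2 := by rw [hy, ← ofReal_pow, Real.sq_sqrt hypos.le]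
  have hsqrt : √y ≠ 0 := (Real.sqrt_pos.2 hypos).ne'
  rcases sq_eq_sq_iff_eq_or_eq_neg.1 hsq with h | h
  · exact ⟨√y, hsqrt, h⟩
  · exact ⟨-√y, neg_ne_zero.2 hsqrt, by rw [h, ofReal_neg]⟩

theorem deriv_besselModJ_ne_zero (hα : -1 < α) (hp0 : 0 < p) (hp1 : p < 1) {z : ℂ}
    (hz : besselModJ α p z = 0) : deriv (besselModJ α p) z ≠ 0 := by
  obtain ⟨hb0, hb1⟩ := rpow_add_one_mem_Ioo hα hp0 hp1
  have hz0 : z ≠ 0 := by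
    rintro rfl
    exact one_ne_zero (besselModJ_zero.symm.trans hz)
  rw [besselModJ_eq_hahnExton] at hz
  rw [(hasDerivAt_besselModJ α hp0 hp1 z).deriv]
  exact mul_ne_zero (deriv_hahnExton_ne_zero hb0 hb1 hp0 hp1 hz) (mul_ne_zero two_ne_zero hz0)

theorem exists_pos_besselModJ_eq_zero (hα : -1 < α) (hp0 : 0 < p) (hp1 : p < 1) :
    ∃ x : ℝ, 0 < x ∧ besselModJ α p x = 0 := by
  obtain ⟨hb0, hb1⟩ := rpow_add_one_mem_Ioo hα hp0 hp1
  obtain ⟨y, hy, hy0⟩ := exists_pos_hahnExton_eq_zero hb0 hb1 hp0 hp1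
  refine ⟨√y, Real.sqrt_pos.2 hy, ?_⟩
  rw [besselModJ_eq_hahnExton, ← ofReal_pow, Real.sq_sqrt hy.le, hy0]

theorem setOf_pos_besselJ_eq_zero (hα : -1 < α) (hp0 : 0 < p) (hp1 : p < 1) :
    {x : ℝ | 0 < x ∧ besselJ α p x = 0} = {x : ℝ | 0 ≤ x ∧ besselModJ α p x = 0} := by
  ext x
  refine ⟨fun ⟨hx, h⟩ => ⟨hx.le, (besselJ_eq_zero_iff hα hp0 hp1 (ofReal_ne_zero.2 hx.ne')).1 h⟩,
    fun ⟨hx, h⟩ => ?_⟩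
  have hx0 : x ≠ 0 := by
    rintro rfl
    exact one_ne_zero (besselModJ_zero.symm.trans h)
  exact ⟨hx.lt_of_ne' hx0, (besselJ_eq_zero_iff hα hp0 hp1 (ofReal_ne_zero.2 hx0)).2 h⟩

theorem sq_mem_Ioo (hq0 : 0 < q) (hq1 : q < 1) : q ^ 2 ∈ Set.Ioo (0 : ℝ) 1 :=
  ⟨by positivity, pow_lt_one₀ hq0.le hq1 two_ne_zero⟩

theorem isLeast_besselZero (hα : -1 < α) (hq0 : 0 < q) (hq1 : q < 1) :
    IsLeast {x : ℝ | 0 < x ∧ besselJ α (q ^ 2) x = 0} (besselZero α q) := by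
  obtain ⟨hp0, hp1⟩ := sq_mem_Ioo hq0 hq1
  obtain ⟨x, hx, hx0⟩ := exists_pos_besselModJ_eq_zero hα hp0 hp1
  have hclosed : IsClosed {x : ℝ | 0 ≤ x ∧ besselModJ α (q ^ 2) x = 0} :=
    (isClosed_le continuous_const continuous_id).inter (isClosed_eq
      ((differentiable_besselModJ α hp0 hp1).continuous.comp continuous_ofReal) continuous_const)
  have hbdd : BddBelow {x : ℝ | 0 ≤ x ∧ besselModJ α (q ^ 2) x = 0} := ⟨0, fun x hx => hx.1⟩
  rw [besselZero, setOf_pos_besselJ_eq_zero hα hp0 hp1]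
  exact hclosed.isLeast_csInf ⟨x, hx.le, hx0⟩ hbdd

theorem besselZero_pos (hα : -1 < α) (hq0 : 0 < q) (hq1 : q < 1) : 0 < besselZero α q :=
  (isLeast_besselZero hα hq0 hq1).1.1

theorem besselModJ_besselZero (hα : -1 < α) (hq0 : 0 < q) (hq1 : q < 1) :
    besselModJ α (q ^ 2) (besselZero α q) = 0 := by
  obtain ⟨hp0, hp1⟩ := sq_mem_Ioo hq0 hq1
  obtain ⟨hpos, hzero⟩ := (isLeast_besselZero hα hq0 hq1).1
  exact (besselJ_eq_zero_iff hα hp0 hp1 (ofReal_ne_zero.2 hpos.ne')).1 hzero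

theorem eq_or_eq_neg_besselZero (hα : -1 < α) (hq0 : 0 < q) (hq1 : q < 1) {z : ℂ}
    (hz : besselModJ α (q ^ 2) z = 0) (hnorm : ‖z‖ ≤ besselZero α q) :
    z = besselZero α q ∨ z = -besselZero α q := by
  obtain ⟨hp0, hp1⟩ := sq_mem_Ioo hq0 hq1
  obtain ⟨x, hx, rfl⟩ := exists_ofReal_of_besselModJ_eq_zero hα hp0 hp1 hz
  have habs : besselModJ α (q ^ 2) (|x| : ℝ) = 0 := by
    rcases abs_choice x with h | h <;> rw [h]
    · exact hz
    · rw [ofReal_neg, besselModJ_neg, hz]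
  have hle : besselZero α q ≤ |x| := (isLeast_besselZero hα hq0 hq1).2 ⟨abs_pos.2 hx,
    (besselJ_eq_zero_iff hα hp0 hp1 (ofReal_ne_zero.2 (abs_pos.2 hx).ne')).2 habs⟩
  rw [norm_real, Real.norm_eq_abs] at hnorm
  exact_mod_cast eq_or_eq_neg_of_abs_eq (le_antisymm hnorm hle)

end BesselZeros

section GeneratingFunction

variable {α q : ℝ}

/-- The factor `(1 - q) q^{-1/4} / 2` by which `gBessel` rescales the argument of `besselModJ`. -/
def besselScale (q : ℝ) : ℝ := (1 - q) * q ^ (-(1 / 4) : ℝ) / 2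

/-- The numerator `exp_q(zt) exp_q(-t/2)` of the generating function. -/
def genFunNumerator (q : ℝ) (z t : ℂ) : ℂ := qExp q (z * t) * qExp q (-t / 2)

/-- The pole `2 i η_{α,1}` of the generating function; the other pole of the same modulus is its
negative. -/
def genFunPole (α q : ℝ) : ℂ := 2 * eta α q * I

/-- The `n`-th Taylor coefficient at the origin of the sum of the principal parts of the generating
function at `genFunPole` and its negative. -/
def genFunPolarCoeff (α q : ℝ) (z : ℂ) (n : ℕ) : ℂ :=
  (genFunNumerator q z (genFunPole α q) / genFunPole α q ^ (n + 1) -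
    genFunNumerator q z (-genFunPole α q) / (-genFunPole α q) ^ (n + 1)) /
    (I * besselScale q * deriv (besselModJ α (q ^ 2)) (besselZero α q))

theorem gBessel_eq (α q : ℝ) (t : ℂ) :
    gBessel α q t = besselModJ α (q ^ 2) (besselScale q * t) := by
  rw [gBessel, besselScale]
  push_cast
  ring_nf

theorem besselScale_pos (hq0 : 0 < q) (hq1 : q < 1) : 0 < besselScale q :=
  half_pos (mul_pos (sub_pos.2 hq1) (Real.rpow_pos_of_pos hq0 _))

theorem four_mul_rpow_div_eq (hq0 : 0 < q) :
    4 * ((q ^ (1 / 4 : ℝ) : ℝ) : ℂ) / (1 - (q : ℂ)) = 2 / besselScale q := by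
  rw [besselScale, Real.rpow_neg hq0.le]
  push_cast
  rw [div_div_eq_mul_div, mul_comm (1 - (q : ℂ)), ← div_div, div_inv_eq_mul]
  norm_num

theorem besselScale_mul_two_mul_eta (hq0 : 0 < q) (hq1 : q < 1) :
    besselScale q * (2 * eta α q) = besselZero α q := by
  have h1q : 1 - q ≠ 0 := (sub_pos.2 hq1).ne'
  have hroot : q ^ (1 / 4 : ℝ) ≠ 0 := (Real.rpow_pos_of_pos hq0 _).ne'
  rw [besselScale, eta, Real.rpow_neg hq0.le]
  field_simp

theorem eta_pos (hα : -1 < α) (hq0 : 0 < q) (hq1 : q < 1) : 0 < eta α q :=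
  div_pos (mul_pos (Real.rpow_pos_of_pos hq0 _) (besselZero_pos hα hq0 hq1)) (sub_pos.2 hq1)

theorem hasDerivAt_gBessel_I_mul (α : ℝ) (hq0 : 0 < q) (hq1 : q < 1) (t : ℂ) :
    HasDerivAt (fun t => gBessel α q (I * t))
      (I * besselScale q * deriv (besselModJ α (q ^ 2)) (besselScale q * (I * t))) t := by
  obtain ⟨hp0, hp1⟩ := sq_mem_Ioo hq0 hq1
  have hinner : HasDerivAt (fun t : ℂ => besselScale q * (I * t)) (besselScale q * (I * 1)) t :=
    ((hasDerivAt_id' t).const_mul I).const_mul _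
  have hcomp := (differentiable_besselModJ α hp0 hp1 _).hasDerivAt.comp t hinner
  simp only [gBessel_eq]
  exact hcomp.congr_deriv (by ring)

theorem differentiable_genFunNumerator (hq0 : 0 < q) (hq1 : q < 1) (z : ℂ) :
    Differentiable ℂ (genFunNumerator q z) := by
  have hexp := differentiable_qExp hq0 hq1
  exact (hexp.comp (f := fun t : ℂ => z * t) (by fun_prop)).mul
    (hexp.comp (f := fun t : ℂ => -t / 2) (by fun_prop))

theorem besselScale_mul_I_mul_genFunPole (hq0 : 0 < q) (hq1 : q < 1) :
    besselScale q * (I * genFunPole α q) = -besselZero α q := by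
  rw [← besselScale_mul_two_mul_eta hq0 hq1, genFunPole]
  push_cast
  linear_combination (2 * besselScale q * eta α q : ℂ) * I_sq

theorem gBessel_I_mul_genFunPole (hα : -1 < α) (hq0 : 0 < q) (hq1 : q < 1) :
    gBessel α q (I * genFunPole α q) = 0 := by
  rw [gBessel_eq, besselScale_mul_I_mul_genFunPole hq0 hq1, besselModJ_neg,
    besselModJ_besselZero hα hq0 hq1]

theorem gBessel_neg (α q : ℝ) (t : ℂ) : gBessel α q (-t) = gBessel α q t := by
  rw [gBessel_eq, gBessel_eq, mul_neg, besselModJ_neg]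

theorem deriv_gBessel_I_mul_genFunPole (hq0 : 0 < q) (hq1 : q < 1) :
    deriv (fun t => gBessel α q (I * t)) (genFunPole α q) =
      -(I * besselScale q * deriv (besselModJ α (q ^ 2)) (besselZero α q)) := by
  rw [(hasDerivAt_gBessel_I_mul α hq0 hq1 _).deriv, besselScale_mul_I_mul_genFunPole hq0 hq1,
    deriv_besselModJ_neg, mul_neg]

theorem deriv_gBessel_I_mul_neg_genFunPole (hq0 : 0 < q) (hq1 : q < 1) :
    deriv (fun t => gBessel α q (I * t)) (-genFunPole α q) =
      I * besselScale q * deriv (besselModJ α (q ^ 2)) (besselZero α q) := by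
  rw [(hasDerivAt_gBessel_I_mul α hq0 hq1 _).deriv, mul_neg, mul_neg,
    besselScale_mul_I_mul_genFunPole hq0 hq1, neg_neg]

theorem eq_or_eq_neg_of_gBessel_I_mul_eq_zero (hα : -1 < α) (hq0 : 0 < q) (hq1 : q < 1) {t : ℂ}
    (ht : ‖t‖ ≤ 2 * eta α q) (hzero : gBessel α q (I * t) = 0) :
    t = genFunPole α q ∨ t = -genFunPole α q := by
  have hσ := besselScale_pos hq0 hq1
  have hcancel {w : ℂ} (hw : besselScale q * (I * t) = besselScale q * (I * w)) : t = w :=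
    mul_left_cancel₀ I_ne_zero (mul_left_cancel₀ (ofReal_ne_zero.2 hσ.ne') hw)
  rw [gBessel_eq] at hzero
  have hnorm : ‖besselScale q * (I * t)‖ ≤ besselZero α q := by
    rw [norm_mul, norm_mul, norm_I, one_mul, norm_real, Real.norm_of_nonneg hσ.le,
      ← besselScale_mul_two_mul_eta hq0 hq1]
    gcongr
  rcases eq_or_eq_neg_besselZero hα hq0 hq1 hzero hnorm with h | h
  · refine .inr (hcancel ?_)
    rw [h, mul_neg, mul_neg, besselScale_mul_I_mul_genFunPole hq0 hq1, neg_neg]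
  · exact .inl (hcancel (by rw [h, besselScale_mul_I_mul_genFunPole hq0 hq1]))

theorem isLittleO_taylorCoeff_genFun (hα : -1 < α) (hq0 : 0 < q) (hq1 : q < 1) (z : ℂ) :
    (fun n => taylorCoeff (genFun α q z) n - genFunPolarCoeff α q z n)
      =o[atTop] fun n => ((2 * eta α q) ^ n)⁻¹ := by
  have hη := eta_pos hα hq0 hq1
  obtain ⟨hp0, hp1⟩ := sq_mem_Ioo hq0 hq1
  have hs : genFunPole α q ≠ 0 :=
    mul_ne_zero (mul_ne_zero two_ne_zero (ofReal_ne_zero.2 hη.ne')) I_ne_zero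
  have hD : I * besselScale q * deriv (besselModJ α (q ^ 2)) (besselZero α q) ≠ 0 :=
    mul_ne_zero (mul_ne_zero I_ne_zero (ofReal_ne_zero.2 (besselScale_pos hq0 hq1).ne'))
      (deriv_besselModJ_ne_zero hα hp0 hp1 (besselModJ_besselZero hα hq0 hq1))
  have hG := gBessel_I_mul_genFunPole hα hq0 hq1
  have hG' := deriv_gBessel_I_mul_genFunPole (α := α) hq0 hq1
  have hG'neg := deriv_gBessel_I_mul_neg_genFunPole (α := α) hq0 hq1
  have hball (t : ℂ) (ht : t ∈ Metric.closedBall 0 (2 * eta α q)) :=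
    eq_or_eq_neg_of_gBessel_I_mul_eq_zero hα hq0 hq1 (mem_closedBall_zero_iff.1 ht)
  have hdarboux := isLittleO_taylorCoeff_div_add_sum (S := {genFunPole α q, -genFunPole α q})
    (mul_pos two_pos hη) isOpen_univ (Set.subset_univ _)
    (differentiable_genFunNumerator hq0 hq1 z).differentiableOn
    (fun t _ => (hasDerivAt_gBessel_I_mul α hq0 hq1 t).differentiableAt.differentiableWithinAt)
    (Set.subset_univ _) (by simp [hs, hs.symm])
    (by simp [mul_neg, gBessel_neg, hG, hG', hG'neg, hD])
    (fun t ht h => by simpa using hball t ht h)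
  refine hdarboux.congr_left fun n => ?_
  rw [Finset.sum_pair (self_ne_neg.2 hs), hG', hG'neg, genFunPolarCoeff]
  change _ = taylorCoeff (fun t => genFunNumerator q z t / gBessel α q (I * t)) n - _
  ring

theorem genFunNumerator_genFunPole (α q : ℝ) (z : ℂ) :
    genFunNumerator q z (genFunPole α q) =
      qExp q (I * (2 * eta α q * z)) * qExp q (-(I * eta α q)) := by
  rw [genFunNumerator, genFunPole]
  ring_nf

theorem genFunNumerator_neg_genFunPole (α q : ℝ) (z : ℂ) :
    genFunNumerator q z (-genFunPole α q) =
      qExp q (-(I * (2 * eta α q * z))) * qExp q (I * eta α q) := by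
  rw [genFunNumerator, genFunPole]
  ring_nf

theorem genFunPolarCoeff_even (hq0 : 0 < q) (z : ℂ) (n : ℕ) :
    genFunPolarCoeff α q z (2 * n) =
      4 * ((q ^ (1 / 4 : ℝ) : ℝ) : ℂ) / (1 - (q : ℂ)) *
        ((-1) ^ (n + 1) * (qCos q (2 * eta α q * z) * qCos q (eta α q) +
          qSin q (2 * eta α q * z) * qSin q (eta α q))) /
        ((2 * eta α q) ^ (2 * n + 1) * deriv (besselModJ α (q ^ 2)) (besselZero α q)) := by
  have hpow : genFunPole α q ^ (2 * n + 1) * I = (-1) ^ (n + 1) * (2 * eta α q) ^ (2 * n + 1) := by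
    rw [genFunPole, mul_pow, mul_assoc, ← pow_succ I, add_assoc, ← mul_add_one, pow_mul I, I_sq,
      mul_comm]
  rw [genFunPolarCoeff, (odd_two_mul_add_one n).neg_pow, div_neg, sub_neg_eq_add, ← add_div,
    div_div, ← mul_assoc, ← mul_assoc, hpow, genFunNumerator_genFunPole,
    genFunNumerator_neg_genFunPole, qCos_mul_add_qSin_mul, four_mul_rpow_div_eq hq0]
  simp only [div_eq_mul_inv, mul_inv, ← inv_pow, inv_neg, inv_one]
  ring

theorem genFunPolarCoeff_odd (hq0 : 0 < q) (z : ℂ) (n : ℕ) :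
    genFunPolarCoeff α q z (2 * n + 1) =
      4 * ((q ^ (1 / 4 : ℝ) : ℝ) : ℂ) / (1 - (q : ℂ)) *
        ((-1) ^ (n + 1) * (qSin q (2 * eta α q * z) * qCos q (eta α q) -
          qCos q (2 * eta α q * z) * qSin q (eta α q))) /
        ((2 * eta α q) ^ (2 * n + 2) * deriv (besselModJ α (q ^ 2)) (besselZero α q)) := by
  have hpow : genFunPole α q ^ (2 * n + 2) = (-1) ^ (n + 1) * (2 * eta α q) ^ (2 * n + 2) := by
    rw [genFunPole, mul_pow, ← mul_add_one, pow_mul I, I_sq, mul_comm]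
  have heven : Even (2 * n + 2) := even_two_mul (n + 1)
  rw [genFunPolarCoeff, add_assoc, heven.neg_pow, hpow, genFunNumerator_genFunPole,
    genFunNumerator_neg_genFunPole, qSin_mul_sub_qCos_mul, four_mul_rpow_div_eq hq0]
  simp only [div_eq_mul_inv, mul_inv, ← inv_pow, inv_neg_one, inv_I]
  ring

end GeneratingFunction

end QBern

end

open Asymptotics Filter in
theorem theorem3p6 (q α : ℝ) (hq0 : 0 < q) (hq1 : q < 1) (hα : -1 < α) :
    IsLeast {x : ℝ | 0 < x ∧ QBern.besselJ α (q ^ 2) (x : ℂ) = 0} (QBern.besselZero α q) ∧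
    deriv (QBern.besselModJ α (q ^ 2)) (QBern.besselZero α q : ℂ) ≠ 0 ∧
    ∀ (z : ℂ) (r : ℝ), 0 < r → r ≤ 2 * QBern.eta α q →
      ((fun n : ℕ => QBern.qBernoulli α q (2 * n) z -
          4 * ((q ^ (1 / 4 : ℝ) : ℝ) : ℂ) / (1 - (q : ℂ)) *
            ((-1) ^ (n + 1) * (QBern.qFact q (2 * n) : ℂ) *
              (QBern.qCos q (2 * (QBern.eta α q : ℂ) * z) * QBern.qCos q (QBern.eta α q : ℂ) +
                QBern.qSin q (2 * (QBern.eta α q : ℂ) * z) * QBern.qSin q (QBern.eta α q : ℂ))) /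
            ((2 * (QBern.eta α q : ℂ)) ^ (2 * n + 1) *
              deriv (QBern.besselModJ α (q ^ 2)) (QBern.besselZero α q : ℂ)))
        =o[atTop] fun n : ℕ => QBern.qFact q (2 * n) * (r ^ (2 * n))⁻¹) ∧
      ((fun n : ℕ => QBern.qBernoulli α q (2 * n + 1) z -
          4 * ((q ^ (1 / 4 : ℝ) : ℝ) : ℂ) / (1 - (q : ℂ)) *
            ((-1) ^ (n + 1) * (QBern.qFact q (2 * n + 1) : ℂ) *
              (QBern.qSin q (2 * (QBern.eta α q : ℂ) * z) * QBern.qCos q (QBern.eta α q : ℂ) -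
                QBern.qCos q (2 * (QBern.eta α q : ℂ) * z) * QBern.qSin q (QBern.eta α q : ℂ))) /
            ((2 * (QBern.eta α q : ℂ)) ^ (2 * n + 2) *
              deriv (QBern.besselModJ α (q ^ 2)) (QBern.besselZero α q : ℂ)))
        =o[atTop] fun n : ℕ => QBern.qFact q (2 * n + 1) * (r ^ (2 * n))⁻¹) := by
  obtain ⟨hp0, hp1⟩ := QBern.sq_mem_Ioo hq0 hq1
  refine ⟨QBern.isLeast_besselZero hα hq0 hq1, QBern.deriv_besselModJ_ne_zero hα hp0 hp1
    (QBern.besselModJ_besselZero hα hq0 hq1), fun z r hr hrη => ⟨?_, ?_⟩⟩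
  · refine (QBern.isLittleO_ofReal_mul_comp (fun n => QBern.qFact q (2 * n)) hr hrη
      (QBern.isLittleO_taylorCoeff_genFun hα hq0 hq1 z) 0).congr_left fun n => ?_
    rw [add_zero, QBern.genFunPolarCoeff_even hq0, QBern.qBernoulli, QBern.taylorCoeff]
    ring
  · refine (QBern.isLittleO_ofReal_mul_comp (fun n => QBern.qFact q (2 * n + 1)) hr hrη
      (QBern.isLittleO_taylorCoeff_genFun hα hq0 hq1 z) 1).congr_left fun n => ?_
    rw [QBern.genFunPolarCoeff_odd hq0, QBern.qBernoulli, QBern.taylorCoeff]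
    ring
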